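/- All structures are finite relational structures, and $\mathbf{A}\to\mathbf{B}$ denotes the existence of a homomorphism. For a structure $\mathbf{B}$ let $\wp(\mathbf{B})$ be the structure whose universe is the set of nonempty subsets of $B$ and in which each $k$-ary symbol $R$ is interpreted by $R^{\wp(\mathbf{B})}=\{(\pi_1 S,\dots,\pi_k S) : \emptyset\neq S\subseteq R^{\mathbf{B}}\}$, and let $\mathsf{Sing}(\wp(\mathbf{B})^n)$ be the induced substructure of $\wp(\mathbf{B})^n$ consisting of the $n$-tuples with at least one singleton coordinate. Peek arc consistency (PAC) solves $\mathsf{CSP}(\mathbf{B})$ if $\mathbf{A}\to\mathbf{B}$ holds for every structure $\mathbf{A}$ similar to $\mathbf{B}$ such that for every $a\in A$ there is a homomorphism $h:\mathbf{A}\to\wp(\mathbf{B})$ with $h(a)$ a singleton. Singleton arc consistency (SAC) solves $\mathsf{CSP}(\mathbf{B})$ if $\mathbf{A}\to\mathbf{B}$ holds for every structure $\mathbf{A}$ similar to $\mathbf{B}$ for which there is a map $s:A\to\wp(B)\setminus\{\emptyset\}$ such that for all $a\in A$ and $b\in s(a)$ there is a homomorphism $h:\mathbf{A}\to\wp(\mathbf{B})$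 with $h(a)=\{b\}$ and $h(a')\subseteq s(a')$ for all $a'\in A$. **Theorem.** Let $\mathbf{B}$ be the structure with universe $\{0,1,2,3\}$, unary relations $U_i^{\mathbf{B}}=\{(i)\}$ for $i=0,1,2,3$, and binary relations $$R_1^{\mathbf{B}}=\{0,1,2,3\}^2\setminus\{(0,0)\},\qquad R_2^{\mathbf{B}}=\{(1,2),(2,3),(3,1),(0,0)\}.$$ Then $\mathbf{B}$ has all constants, that is, for each $b\in B$ some unary relation of $\mathbf{B}$ is $\{(b)\}$. Let $*$ be the idempotent commutative binary operation on $\{0,1,2,3\}$ with $1*2=2$, $2*3=3$, $3*1=1$ and $0*a=a$ for $a\in\{1,2,3\}$. Then $*$ is a 2-semilattice operation (idempotent, commutative, and $x*(x*y)=(x*x)*y$ for all $x,y$), is conservative ($x*y\in\{x,y\}$ for all $x,y$), and is a polymorphism of $\mathbf{B}$ (each relation of $\mathbf{B}$ is closed under $*$ applied coordinatewise). Moreover, SAC solves $\mathsf{CSP}(\mathbf{B})$, there is no homomorphism $\mathsf{Sing}(\wp(\mathbf{B})^2)\to\mathbf{B}$, and PAC does not solve $\mathsf{CSP}(\mathbf{B})$.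 -/

import Mathlib

namespace ArcCons

open FirstOrder FirstOrder.Language FirstOrder.Language.Structure

/-- The universe `℘(B) \ {∅}` of the structure `℘(B)`. -/
def Pow.{x} (B : Type x) : Type x := {S : Set B // S.Nonempty}

/-- The set underlying an element of `℘(B) \ {∅}`. -/
def Pow.toSet.{x} {B : Type x} (S : Pow B) : Set B := S.1

/-- The relational structure `℘(B)`: a `k`-ary symbol `R` is interpreted by the tuples
`(π₁ S, …, π_k S)` for nonempty `S ⊆ R^B`. -/
instance powStructure.{u, v, x} (L : FirstOrder.Language.{u, v}) [L.IsRelational] (B : Type x)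
    [L.Structure B] : L.Structure (Pow B) where
  funMap f _ := isEmptyElim f
  RelMap {k} R T := ∃ S : Set (Fin k → B), S.Nonempty ∧ (∀ t ∈ S, RelMap R t) ∧
    ∀ i : Fin k, (T i).toSet = (fun t : Fin k → B => t i) '' S

/-- The power `M^n` of a structure, with universe `Fin n → M`. -/
instance productStructure.{u, v, x} (L : FirstOrder.Language.{u, v}) (M : Type x) [L.Structure M] (n : ℕ) :
    L.Structure (Fin n → M) where
  funMap f T := fun i => funMap f (fun j => T j i)
  RelMap R T := ∀ i, RelMap R (fun j => T j i)

/-- `Sing(℘(B)^n)`: the induced substructure of `℘(B)^n` on the `n`-tuples having at least one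
singleton coordinate. -/
def Sing.{u, v, x} (L : FirstOrder.Language.{u, v}) [L.IsRelational] (B : Type x) [L.Structure B] (n : ℕ) :
    L.Substructure (Fin n → Pow B) where
  carrier := {T | ∃ (i : Fin n) (b : B), (T i).toSet = {b}}
  fun_mem f := isEmptyElim f

/-- The peek arc consistency condition for the instance `(A, B)`. -/
def PACC.{u, v, w, x} (L : FirstOrder.Language.{u, v}) [L.IsRelational] (A : Type w) (B : Type x)
    [L.Structure A] [L.Structure B] : Prop :=
  ∀ a : A, ∃ h : A →[L] Pow B, ∃ b : B, (h a).toSet = {b}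

/-- The singleton arc consistency condition for the instance `(A, B)`. -/
def SACC.{u, v, w, x} (L : FirstOrder.Language.{u, v}) [L.IsRelational] (A : Type w) (B : Type x)
    [L.Structure A] [L.Structure B] : Prop :=
  ∃ s : A → Pow B, ∀ a : A, ∀ b ∈ (s a).toSet, ∃ h : A →[L] Pow B,
    (h a).toSet = {b} ∧ ∀ a' : A, (h a').toSet ⊆ (s a').toSet

/-- Peek arc consistency solves `CSP(B)`. Input structures are finite. -/
def PACSolves.{w, u, v, x} (L : FirstOrder.Language.{u, v}) [L.IsRelational] (B : Type x)
    [L.Structure B] : Prop :=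
  ∀ (A : Type w) [Finite A] [L.Structure A], PACC L A B → Nonempty (A →[L] B)

/-- Singleton arc consistency solves `CSP(B)`. Input structures are finite. -/
def SACSolves.{w, u, v, x} (L : FirstOrder.Language.{u, v}) [L.IsRelational] (B : Type x)
    [L.Structure B] : Prop :=
  ∀ (A : Type w) [Finite A] [L.Structure A], SACC L A B → Nonempty (A →[L] B)

/-- For each `b` there is a unary symbol interpreted by `{(b)}`. -/
def HasAllConstants.{u, v, x} (L : FirstOrder.Language.{u, v}) (B : Type x) [L.Structure B] : Prop :=
  ∀ b : B, ∃ R : L.Relations 1, {t : Fin 1 → B | RelMap R t} = {![b]}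

/-- The `n`-ary operation `f` preserves every relation of the relational structure `B`. -/
def IsPolymorphism.{u, v, x} (L : FirstOrder.Language.{u, v}) [L.IsRelational] {B : Type x} [L.Structure B]
    {n : ℕ} (f : (Fin n → B) → B) : Prop :=
  ∀ (k : ℕ) (R : L.Relations k) (t : Fin n → Fin k → B),
    (∀ i, RelMap R (t i)) → RelMap R (fun j => f (fun i => t i j))

structure IsTwoSemilattice.{x} {G : Type x} (op : G → G → G) : Prop where
  idem : ∀ x, op x x = x
  comm : ∀ x y, op x y = op y x
  restricted_assoc : ∀ x y, op x (op x y) = op (op x x) y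

def IsConservative.{x} {G : Type x} (op : G → G → G) : Prop :=
  ∀ x y, op x y ∈ ({x, y} : Set G)

/-- The relation symbols `U₀, U₁, U₂, U₃` (unary) and `R₁, R₂` (binary). -/
inductive TemplateSymbol : ℕ → Type
  | U (b : Fin 4) : TemplateSymbol 1
  | R₁ : TemplateSymbol 2
  | R₂ : TemplateSymbol 2

def templateSignature : FirstOrder.Language.{0, 0} := ⟨fun _ => Empty, TemplateSymbol⟩

instance templateSignature_isRelational : templateSignature.IsRelational :=
  fun _ => inferInstanceAs (IsEmpty Empty)

/-- The relations of the template on `{0, 1, 2, 3}`. -/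
def templateRel : {k : ℕ} → TemplateSymbol k → Set (Fin k → Fin 4)
  | _, .U b => {![b]}
  | _, .R₁ => Set.univ \ {![0, 0]}
  | _, .R₂ => {![1, 2], ![2, 3], ![3, 1], ![0, 0]}

/-- The template `B` with universe `{0, 1, 2, 3}`. -/
instance templateStructure : templateSignature.Structure (Fin 4) where
  funMap f _ := isEmptyElim f
  RelMap R t := t ∈ templateRel R

/-- The idempotent commutative operation on `{0, 1, 2, 3}` with `1 * 2 = 2`, `2 * 3 = 3`,
`3 * 1 = 1` and `0 * a = a`. -/
def star (a b : Fin 4) : Fin 4 :=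
  (![![0, 1, 2, 3],
     ![1, 1, 2, 1],
     ![2, 2, 2, 3],
     ![3, 1, 3, 3] ] : Fin 4 → Fin 4 → Fin 4) a b

end ArcCons

universe w

/-!
On `℘(B)` the graph of a permutation `π` of `B` becomes the graph of `S ↦ π '' S`, and so a
homomorphism `A → ℘(B)` that is a singleton at one element of `A` is one on its whole
`R₂`-component. To solve an instance from a singleton arc consistency witness `s`, fix on each
component such a homomorphism whose values avoid `0` wherever `s` is not `{0}`. The resulting map
respects `R₂` since the choice is constant on components, the unary relations since it stays
inside `s`, and `R₁` since `s` is itself a homomorphism and so never takes the value `{0}` at both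
ends of an `R₁`-edge.

Peek arc consistency fails because both `{0}` and `{1, 2, 3}` are invariant under the permutation
`(1 2 3)` with graph `R₂`: a homomorphism `Sing(℘(B)²) → B` must send `({0}, {1, 2, 3})` and
`({1, 2, 3}, {0})` to its only fixed point `0`, but these two pairs are `R₁`-related.
-/

namespace ArcCons

open FirstOrder FirstOrder.Language FirstOrder.Language.Structure

section PowerStructure

variable {L : Language} [L.IsRelational] {B : Type*} [L.Structure B]

theorem exists_relMap_of_relMap_pow {k : ℕ} {R : L.Relations k} {T : Fin k → Pow B}
    (h : RelMap R T) : ∃ t, RelMap R t ∧ ∀ i, t i ∈ (T i).toSet := by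
  obtain ⟨S, ⟨t, ht⟩, hR, hT⟩ := h
  exact ⟨t, hR t ht, fun i => hT i ▸ Set.mem_image_of_mem _ ht⟩

theorem relMap_of_toSet_eq_singleton {k : ℕ} {R : L.Relations k} {T : Fin k → Pow B}
    {t : Fin k → B} (hT : ∀ i, (T i).toSet = {t i}) (h : RelMap R T) : RelMap R t := by
  obtain ⟨u, hu, huT⟩ := exists_relMap_of_relMap_pow h
  obtain rfl : u = t := funext fun i => (hT i).subset (huT i)
  exact hu

theorem relMap_pow_iff {k : ℕ} [NeZero k] {R : L.Relations k} {T : Fin k → Pow B} :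
    RelMap R T ↔ ∀ i, ∀ b ∈ (T i).toSet, ∃ t, RelMap R t ∧ (∀ j, t j ∈ (T j).toSet) ∧ t i = b := by
  constructor
  · rintro ⟨S, -, hR, hT⟩ i b hb
    obtain ⟨t, ht, rfl⟩ := (hT i).subset hb
    exact ⟨t, hR t ht, fun j => hT j ▸ Set.mem_image_of_mem _ ht, rfl⟩
  · intro h
    refine ⟨{t | RelMap R t ∧ ∀ j, t j ∈ (T j).toSet}, ?_, fun t ht => ht.1, fun i => ?_⟩
    · obtain ⟨b, hb⟩ := (T 0).2
      obtain ⟨t, hR, ht, -⟩ := h 0 b hb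
      exact ⟨t, hR, ht⟩
    · refine Set.Subset.antisymm (fun b hb => ?_) (Set.image_subset_iff.2 fun t ht => ht.2 i)
      obtain ⟨t, hR, ht, rfl⟩ := h i b hb
      exact ⟨t, ⟨hR, ht⟩, rfl⟩

theorem relMap_of_mem_of_relMap_pow {R : L.Relations 1} {T : Fin 1 → Pow B} (h : RelMap R T)
    {t : Fin 1 → B} (ht : t 0 ∈ (T 0).toSet) : RelMap R t := by
  obtain ⟨u, hu, -, hut⟩ := relMap_pow_iff.1 h 0 (t 0) ht
  obtain rfl : u = t := funext <| Fin.forall_fin_one.2 hut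
  exact hu

theorem relMap_pow_of_forall_mem {k : ℕ} {R : L.Relations k} {T : Fin k → Pow B}
    (h : ∀ t : Fin k → B, (∀ i, t i ∈ (T i).toSet) → RelMap R t) : RelMap R T := by
  have hne : (Set.univ.pi fun i => (T i).toSet).Nonempty :=
    Set.univ_pi_nonempty_iff.2 fun i => (T i).2
  exact ⟨_, hne, fun t ht => h t fun i => ht i trivial, fun _ => (Set.eval_image_univ_pi hne).symm⟩

theorem relMap_pow_iff_eq_image {R : L.Relations 2} {g : B → B}
    (hR : ∀ t : Fin 2 → B, RelMap R t ↔ t 1 = g (t 0)) {T : Fin 2 → Pow B} :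
    RelMap R T ↔ (T 1).toSet = g '' (T 0).toSet := by
  constructor
  · rintro ⟨S, -, hS, hT⟩
    rw [hT 0, hT 1, Set.image_image]
    exact Set.image_congr fun t ht => (hR t).1 (hS t ht)
  · intro h
    refine ⟨(fun b => ![b, g b]) '' (T 0).toSet, (T 0).2.image _, ?_, ?_⟩
    · rintro _ ⟨b, -, rfl⟩
      exact (hR _).2 rfl
    · rw [Fin.forall_fin_two, h, Set.image_image, Set.image_image]
      exact ⟨(Set.image_id _).symm, rfl⟩

end PowerStructure

section PeekArcConsistency

universe x

variable {L : Language} [L.IsRelational] {B : Type x} [L.Structure B]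

instance [Finite B] : Finite (Pow B) :=
  inferInstanceAs (Finite {S : Set B // S.Nonempty})

/-- The `i`-th coordinate projection `Sing(℘(B)^n) → ℘(B)`. -/
def Sing.proj {n : ℕ} (i : Fin n) : Sing L B n →[L] Pow B where
  toFun T := T.1 i
  map_fun' f := isEmptyElim f
  map_rel' _ _ h := h i

theorem PACC.sing (n : ℕ) : PACC L (Sing L B n) B := by
  rintro ⟨T, i, b, h⟩
  exact ⟨Sing.proj i, b, h⟩

theorem PACC.comp {A A' : Type*} [L.Structure A] [L.Structure A'] (h : PACC L A B)
    (g : A' →[L] A) : PACC L A' B := by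
  intro a
  obtain ⟨k, b, hb⟩ := h (g a)
  exact ⟨k.comp g, b, hb⟩

theorem PACSolves.nonempty_hom_sing [Finite B] (h : PACSolves.{max x w} L B) (n : ℕ) :
    Nonempty (Sing L B n →[L] B) := by
  let _ : L.Structure (ULift.{w} (Sing L B n)) := Equiv.ulift.symm.inducedStructure
  let e : Sing L B n ≃[L] ULift.{w} (Sing L B n) := Equiv.ulift.symm.inducedStructureEquiv
  obtain ⟨f⟩ := h (ULift.{w} (Sing L B n)) ((PACC.sing n).comp e.symm.toHom)
  exact ⟨f.comp e.toHom⟩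

theorem map_sing_eq_of_image_eq {R : L.Relations 2} {g : B → B}
    (hR : ∀ t : Fin 2 → B, RelMap R t ↔ t 1 = g (t 0)) {n : ℕ} (f : Sing L B n →[L] B)
    {T : Sing L B n} (hT : ∀ i, g '' (T.1 i).toSet = (T.1 i).toSet) : g (f T) = f T := by
  have hTT : RelMap R ![T, T] := fun i => (relMap_pow_iff_eq_image hR).2 (hT i).symm
  exact ((hR _).1 (f.map_rel R _ hTT)).symm

theorem isEmpty_hom_sing_two [Nontrivial B] {R₁ R₂ : L.Relations 2} {o : B} {π : Equiv.Perm B}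
    (hR₁ : ∀ t : Fin 2 → B, RelMap R₁ t ↔ ¬ (t 0 = o ∧ t 1 = o))
    (hR₂ : ∀ t : Fin 2 → B, RelMap R₂ t ↔ t 1 = π (t 0)) (hπ : ∀ b, π b = b ↔ b = o) :
    IsEmpty (Sing L B 2 →[L] B) := by
  refine ⟨fun f => ?_⟩
  let z : Pow B := ⟨{o}, Set.singleton_nonempty o⟩
  let c : Pow B := ⟨{o}ᶜ, exists_ne o⟩
  have hz : π '' z.toSet = z.toSet := by
    change π '' {o} = {o}
    rw [Set.image_singleton, (hπ o).2 rfl]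
  have hc : π '' c.toSet = c.toSet :=
    (Set.image_compl_eq π.bijective).trans (congrArg _ hz)
  let x : Sing L B 2 := ⟨![z, c], 0, o, rfl⟩
  let y : Sing L B 2 := ⟨![c, z], 1, o, rfl⟩
  have hx : f x = o := (hπ _).1 (map_sing_eq_of_image_eq hR₂ f (Fin.forall_fin_two.2 ⟨hz, hc⟩))
  have hy : f y = o := (hπ _).1 (map_sing_eq_of_image_eq hR₂ f (Fin.forall_fin_two.2 ⟨hc, hz⟩))
  have hxy : RelMap R₁ ![x, y] := Fin.forall_fin_two.2
    ⟨relMap_pow_of_forall_mem fun t ht => (hR₁ t).2 fun h => ht 1 h.2,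
      relMap_pow_of_forall_mem fun t ht => (hR₁ t).2 fun h => ht 0 h.1⟩
  exact (hR₁ _).1 (f.map_rel R₁ _ hxy) ⟨hx, hy⟩

end PeekArcConsistency

section SingletonArcConsistency

theorem exists_choice_respecting {α ι : Type*} {r : α → α → Prop} {p : ι → α → Prop}
    (hp : ∀ i a a', r a a' → (p i a ↔ p i a')) (h : ∀ a, ∃ i, p i a) :
    ∃ c : α → ι, (∀ a a', r a a' → c a = c a') ∧ ∀ a, p (c a) a := by
  let p' (i : ι) : Quot r → Prop := Quot.lift (p i) fun a a' haa' => propext (hp i a a' haa')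
  have hp' : ∀ q, ∃ i, p' i q := Quot.ind h
  choose c hc using hp'
  exact ⟨fun a => c (Quot.mk r a), fun _ _ haa' => congrArg c (Quot.sound haa'),
    fun a => hc (Quot.mk r a)⟩

variable {L : Language} [L.IsRelational] {A B : Type*} [L.Structure A] [L.Structure B]

variable (L) in
/-- The map `s` witnesses the singleton arc consistency condition `SACC L A B`. -/
def IsSACWitness (s : A → Pow B) : Prop :=
  ∀ a, ∀ b ∈ (s a).toSet, ∃ h : A →[L] Pow B,
    (h a).toSet = {b} ∧ ∀ a', (h a').toSet ⊆ (s a').toSet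

theorem IsSACWitness.relMap {s : A → Pow B} (hs : IsSACWitness L s) {k : ℕ} [NeZero k]
    {R : L.Relations k} {t : Fin k → A} (ht : RelMap R t) : RelMap R (s ∘ t) := by
  refine relMap_pow_iff.2 fun i b hb => ?_
  obtain ⟨h, hi, hsub⟩ := hs (t i) b hb
  obtain ⟨u, hu, hut, rfl⟩ := relMap_pow_iff.1 (h.map_rel R t ht) i b (hi ▸ rfl)
  exact ⟨u, hu, fun j => hsub _ (hut j), rfl⟩

theorem image_eq_singleton_apply_iff {α β : Type*} {g : α → β} (hg : g.Injective) {S : Set α}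
    {b : α} : g '' S = {g b} ↔ S = {b} := by
  rw [← Set.image_singleton, hg.image_injective.eq_iff]

theorem IsSACWitness.exists_selection {s : A → Pow B} (hs : IsSACWitness L s)
    {R : L.Relations 2} {g : B → B} (hg : g.Injective)
    (hR : ∀ t : Fin 2 → B, RelMap R t ↔ t 1 = g (t 0)) {C : A → Set B}
    (hCs : ∀ a, C a ⊆ (s a).toSet) (hCne : ∀ a, (C a).Nonempty)
    (hC : ∀ t : Fin 2 → A, RelMap R t → C (t 1) = g '' C (t 0)) :
    ∃ f : A → B, (∀ a, f a ∈ C a) ∧ ∀ t, RelMap R t → RelMap R (f ∘ t) := by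
  let r (a a' : A) : Prop := ∃ t : Fin 2 → A, RelMap R t ∧ t 0 = a ∧ t 1 = a'
  let p (h : A →[L] Pow B) (a : A) : Prop := ∃ b ∈ C a, (h a).toSet = {b}
  have hp : ∀ h a a', r a a' → (p h a ↔ p h a') := by
    rintro h _ _ ⟨t, ht, rfl, rfl⟩
    have himage : (h (t 1)).toSet = g '' (h (t 0)).toSet :=
      (relMap_pow_iff_eq_image hR).1 (h.map_rel R t ht)
    simp only [p, hC t ht, himage, Set.exists_mem_image, image_eq_singleton_apply_iff hg]
  have hex : ∀ a, ∃ h, p h a := fun a => by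
    obtain ⟨b, hb⟩ := hCne a
    obtain ⟨h, hh, -⟩ := hs a b (hCs a hb)
    exact ⟨h, b, hb, hh⟩
  obtain ⟨H, hH, hpH⟩ := exists_choice_respecting hp hex
  choose f hfC hf using hpH
  refine ⟨f, hfC, fun t ht => ?_⟩
  have hH₁ : H (t 0) = H (t 1) := hH _ _ ⟨t, ht, rfl, rfl⟩
  exact relMap_of_toSet_eq_singleton (Fin.forall_fin_two.2 ⟨hf (t 0), hH₁ ▸ hf (t 1)⟩)
    ((H (t 0)).map_rel R t ht)

/-- The elements of `S` other than `o`, or `{o}` if `S = {o}`: the values by which a solution may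
pick from `S` while taking the value `o` only when forced to. -/
def avoiding (o : B) (S : Set B) : Set B :=
  {b ∈ S | b = o → S = {o}}

theorem avoiding_subset (o : B) (S : Set B) : avoiding o S ⊆ S :=
  Set.sep_subset _ _

theorem avoiding_nonempty (o : B) {S : Set B} (hS : S.Nonempty) : (avoiding o S).Nonempty := by
  by_cases h : S = {o}
  · exact ⟨o, h ▸ rfl, fun _ => h⟩
  · obtain ⟨b, hb, hbo⟩ : ∃ b ∈ S, b ≠ o := by
      by_contra! hall
      exact h (hS.subset_singleton_iff.1 hall)
    exact ⟨b, hb, fun e => absurd e hbo⟩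

theorem image_avoiding {g : B → B} (hg : g.Injective) {o : B} (ho : g o = o) (S : Set B) :
    avoiding o (g '' S) = g '' avoiding o S := by
  have himage : g '' S = {o} ↔ S = {o} := by
    simpa only [ho] using image_eq_singleton_apply_iff hg (b := o)
  have heq : ∀ b, g b = o ↔ b = o := fun b => by rw [← hg.eq_iff (a := b), ho]
  ext c
  simp only [avoiding, himage, Set.mem_ofPred_eq, Set.mem_image]
  constructor
  · rintro ⟨⟨b, hb, rfl⟩, h⟩
    exact ⟨b, ⟨hb, fun e => h ((heq b).2 e)⟩, rfl⟩
  · rintro ⟨b, ⟨hb, h⟩, rfl⟩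
    exact ⟨⟨b, hb, rfl⟩, fun e => h ((heq b).1 e)⟩

theorem IsSACWitness.exists_selection_preserving {s : A → Pow B} (hs : IsSACWitness L s)
    {R₁ R₂ : L.Relations 2} {o : B} {g : B → B} (hg : g.Injective) (ho : g o = o)
    (hR₁ : ∀ t : Fin 2 → B, RelMap R₁ t ↔ ¬ (t 0 = o ∧ t 1 = o))
    (hR₂ : ∀ t : Fin 2 → B, RelMap R₂ t ↔ t 1 = g (t 0)) :
    ∃ f : A → B, (∀ a, f a ∈ (s a).toSet) ∧ (∀ t, RelMap R₁ t → RelMap R₁ (f ∘ t)) ∧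
      ∀ t, RelMap R₂ t → RelMap R₂ (f ∘ t) := by
  have hC : ∀ t : Fin 2 → A, RelMap R₂ t →
      avoiding o (s (t 1)).toSet = g '' avoiding o (s (t 0)).toSet := fun t ht => by
    rw [← image_avoiding hg ho]
    exact congrArg _ ((relMap_pow_iff_eq_image hR₂).1 (hs.relMap ht))
  obtain ⟨f, hf, hfR₂⟩ := hs.exists_selection hg hR₂ (fun a => avoiding_subset o (s a).toSet)
    (fun a => avoiding_nonempty o (s a).2) hC
  refine ⟨f, fun a => (hf a).1, fun t ht => (hR₁ _).2 fun ⟨h₀, h₁⟩ => ?_, hfR₂⟩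
  have hst : ∀ i, ((s ∘ t) i).toSet = {o} :=
    Fin.forall_fin_two.2 ⟨(hf (t 0)).2 h₀, (hf (t 1)).2 h₁⟩
  exact (hR₁ fun _ => o).1 (relMap_of_toSet_eq_singleton hst (hs.relMap ht)) ⟨rfl, rfl⟩

end SingletonArcConsistency

section Template

/-- The permutation of `{0, 1, 2, 3}` whose graph is `R₂`. -/
def rotation : Equiv.Perm (Fin 4) :=
  c[1, 2, 3]

theorem relMap_R₁ (t : Fin 2 → Fin 4) :
    RelMap (L := templateSignature) TemplateSymbol.R₁ t ↔ ¬ (t 0 = 0 ∧ t 1 = 0) := by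
  change t ∈ (Set.univ \ {![0, 0]} : Set _) ↔ _
  simp [funext_iff, Fin.forall_fin_two]

theorem relMap_R₂ (t : Fin 2 → Fin 4) :
    RelMap (L := templateSignature) TemplateSymbol.R₂ t ↔ t 1 = rotation (t 0) := by
  change t ∈ ({![1, 2], ![2, 3], ![3, 1], ![0, 0]} : Set _) ↔ _
  simp only [Set.mem_insert_iff, Set.mem_singleton_iff, funext_iff, Fin.forall_fin_two]
  generalize t 0 = a, t 1 = b
  revert a b
  decide

theorem rotation_eq_self_iff (b : Fin 4) : rotation b = b ↔ b = 0 := by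
  revert b; decide

theorem hasAllConstants_template : HasAllConstants templateSignature (Fin 4) :=
  fun b => ⟨TemplateSymbol.U b, rfl⟩

theorem isTwoSemilattice_star : IsTwoSemilattice star :=
  ⟨by decide, by decide, by decide⟩

theorem isConservative_star : IsConservative star := by
  simp only [IsConservative, Set.mem_insert_iff, Set.mem_singleton_iff]
  decide

theorem star_eq_zero_iff {a b : Fin 4} : star a b = 0 ↔ a = 0 ∧ b = 0 := by
  revert a b; decide

theorem rotation_star (a b : Fin 4) : rotation (star a b) = star (rotation a) (rotation b) := by
  revert a b; decide

theorem isPolymorphism_star :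
    IsPolymorphism templateSignature (fun t : Fin 2 → Fin 4 => star (t 0) (t 1)) := by
  rintro k (b | _ | _) t h
  · obtain rfl : t = fun _ => ![b] := funext h
    exact funext <| Fin.forall_fin_one.2 <| isTwoSemilattice_star.idem b
  · refine (relMap_R₁ _).2 fun ⟨h₀, h₁⟩ => (relMap_R₁ _).1 (h 0) ?_
    exact ⟨(star_eq_zero_iff.1 h₀).1, (star_eq_zero_iff.1 h₁).1⟩
  · have hrot : ∀ i, t i 1 = rotation (t i 0) := fun i => (relMap_R₂ _).1 (h i)
    refine (relMap_R₂ _).2 ?_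
    simp only [hrot, rotation_star]

theorem nonempty_hom_template_of_sacc {A : Type*} [templateSignature.Structure A]
    (h : SACC templateSignature A (Fin 4)) : Nonempty (A →[templateSignature] Fin 4) := by
  obtain ⟨s, hs : IsSACWitness templateSignature s⟩ := h
  obtain ⟨f, hfs, hfR₁, hfR₂⟩ := hs.exists_selection_preserving rotation.injective
    ((rotation_eq_self_iff 0).2 rfl) relMap_R₁ relMap_R₂
  refine ⟨⟨f, fun g => isEmptyElim g, ?_⟩⟩
  rintro k (b | _ | _) t ht
  · exact relMap_of_mem_of_relMap_pow (hs.relMap ht) (hfs (t 0))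
  · exact hfR₁ t ht
  · exact hfR₂ t ht

theorem isEmpty_hom_sing_two_template :
    IsEmpty (Sing templateSignature (Fin 4) 2 →[templateSignature] Fin 4) :=
  isEmpty_hom_sing_two relMap_R₁ relMap_R₂ rotation_eq_self_iff

theorem not_pacSolves_template : ¬ PACSolves.{w} templateSignature (Fin 4) :=
  fun h => (h.nonempty_hom_sing 2).elim isEmpty_hom_sing_two_template.false

end Template

end ArcCons

theorem theorem22_general :
    ArcCons.HasAllConstants ArcCons.templateSignature (Fin 4) ∧
    ArcCons.IsTwoSemilattice ArcCons.star ∧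
    ArcCons.IsConservative ArcCons.star ∧
    ArcCons.IsPolymorphism ArcCons.templateSignature
      (fun t : Fin 2 → Fin 4 => ArcCons.star (t 0) (t 1)) ∧
    (∀ (A : Type w) [ArcCons.templateSignature.Structure A],
      ArcCons.SACC ArcCons.templateSignature A (Fin 4) →
        Nonempty (FirstOrder.Language.Hom ArcCons.templateSignature A (Fin 4))) ∧
    ¬ ArcCons.PACSolves.{w} ArcCons.templateSignature (Fin 4) ∧
    IsEmpty (FirstOrder.Language.Hom ArcCons.templateSignature
      (ArcCons.Sing ArcCons.templateSignature (Fin 4) 2) (Fin 4)) :=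
  ⟨ArcCons.hasAllConstants_template, ArcCons.isTwoSemilattice_star, ArcCons.isConservative_star,
    ArcCons.isPolymorphism_star, fun _ _ => ArcCons.nonempty_hom_template_of_sacc,
    ArcCons.not_pacSolves_template, ArcCons.isEmpty_hom_sing_two_template⟩

theorem theorem22 :
    ArcCons.HasAllConstants ArcCons.templateSignature (Fin 4) ∧
    ArcCons.IsTwoSemilattice ArcCons.star ∧
    ArcCons.IsConservative ArcCons.star ∧
    ArcCons.IsPolymorphism ArcCons.templateSignature
      (fun t : Fin 2 → Fin 4 => ArcCons.star (t 0) (t 1)) ∧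
    ArcCons.SACSolves.{w} ArcCons.templateSignature (Fin 4) ∧
    ¬ ArcCons.PACSolves.{w} ArcCons.templateSignature (Fin 4) ∧
    IsEmpty (FirstOrder.Language.Hom ArcCons.templateSignature
      (ArcCons.Sing ArcCons.templateSignature (Fin 4) 2) (Fin 4)) := by
  obtain ⟨hconst, hsemi, hcons, hpoly, hsac, hpac, hsing⟩ := theorem22_general.{w}
  exact ⟨hconst, hsemi, hcons, hpoly, fun A _ _ => hsac A, hpac, hsing⟩
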